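/- Let $X$ be a complex Banach space and let $T$ be a bounded linear operator on $X$. For a bounded linear operator $S$ on a complex normed space $E$ write $\mathcal{N}(S)$ and $\mathcal{R}(S)$ for its kernel and range, $\alpha(S)=\dim \mathcal{N}(S)$, $\beta(S)=\dim E/\mathcal{R}(S)$, and let $S_{[n]}$ be the restriction of $S$ to $\mathcal{R}(S^n)$, $n\in\mathbb{N}=\{0,1,2,\dots\}$. Put (with $\inf\emptyset=\infty$) $$a_e(S)=\inf\{n:\alpha(S_{[n]})<\infty\},\quad d_e(S)=\inf\{n:\beta(S_{[n]})<\infty\},\quad m_S=\inf\{n:\min\{\alpha(S_{[n]}),\beta(S_{[n]})\}<\infty\}.$$ The operator $S$ is called upper semi-B-Fredholm if $a_e(S)<\infty$ and $\mathcal{R}(S^{a_e(S)+1})$ is closed, and lower semi-B-Fredholm if $d_e(S)<\infty$ and $\mathcal{R}(S^{d_e(S)})$ is closed; it is called upper (resp. lower) semi-Fredholm if it is upper (resp. lower) semi-B-Fredholm and $m_S=0$. Call $T$ quasi upper (resp. quasi lower) semi-B-Fredholm if there are closed $T$-invariant subspaces $M,N$ of $X$ with $X=M\oplus N$ such that the restriction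 of $T$ to $M$ is upper (resp. lower) semi-Fredholm and the restriction of $T$ to $N$ is nilpotent. Then: if $T$ is quasi upper semi-B-Fredholm, then $T$ is upper semi-B-Fredholm; and if $T$ is quasi lower semi-B-Fredholm, then $T$ is lower semi-B-Fredholm. -/

import Mathlib

namespace SemiBFredholm

section

variable {E : Type*} [NormedAddCommGroup E] [NormedSpace ℂ E]

/-- `α(T)`, the dimension of the kernel of `T`. -/
noncomputable def nullity (T : E →L[ℂ] E) : ℕ∞ :=
  Cardinal.toENat (Module.rank ℂ T.ker)

/-- `β(T)`, the codimension of the range of `T`. -/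
noncomputable def defect (T : E →L[ℂ] E) : ℕ∞ :=
  Cardinal.toENat (Module.rank ℂ (E ⧸ T.range))

/-- The range of `T ^ n` is `T`-invariant. -/
theorem apply_mem_range_pow (T : E →L[ℂ] E) (n : ℕ) :
    ∀ x ∈ (T ^ n).range, T x ∈ (T ^ n).range := by
  rintro _ ⟨y, rfl⟩
  refine ⟨T y, ?_⟩
  change (T ^ n * T) y = (T * T ^ n) y
  rw [← pow_succ, ← pow_succ']

/-- `T_[n]`, the restriction of `T` to the range of `T ^ n`. -/
def restrictRangePow (T : E →L[ℂ] E) (n : ℕ) : (T ^ n).range →L[ℂ] (T ^ n).range :=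
  T.restrict (apply_mem_range_pow T n)

/-- `a_e(T) = inf {n | α(T_[n]) < ∞}`, with `inf ∅ = ∞`. -/
noncomputable def essentialAscent (T : E →L[ℂ] E) : ℕ∞ :=
  sInf ((fun n : ℕ => (n : ℕ∞)) '' {n | nullity (restrictRangePow T n) < ⊤})

/-- `d_e(T) = inf {n | β(T_[n]) < ∞}`, with `inf ∅ = ∞`. -/
noncomputable def essentialDescent (T : E →L[ℂ] E) : ℕ∞ :=
  sInf ((fun n : ℕ => (n : ℕ∞)) '' {n | defect (restrictRangePow T n) < ⊤})

/-- `m_T = inf {n | min (α(T_[n])) (β(T_[n])) < ∞}`, with `inf ∅ = ∞`. -/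
noncomputable def essentialDegree (T : E →L[ℂ] E) : ℕ∞ :=
  sInf ((fun n : ℕ => (n : ℕ∞)) ''
    {n | min (nullity (restrictRangePow T n)) (defect (restrictRangePow T n)) < ⊤})

/-- `T` is upper semi-B-Fredholm: `a_e(T) < ∞` and `R(T ^ (a_e(T) + 1))` is closed. -/
def IsUpperSemiBFredholm (T : E →L[ℂ] E) : Prop :=
  ∃ a : ℕ, essentialAscent T = a ∧ IsClosed ((T ^ (a + 1)).range : Set E)

/-- `T` is lower semi-B-Fredholm: `d_e(T) < ∞` and `R(T ^ d_e(T))` is closed. -/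
def IsLowerSemiBFredholm (T : E →L[ℂ] E) : Prop :=
  ∃ d : ℕ, essentialDescent T = d ∧ IsClosed ((T ^ d).range : Set E)

/-- `T` is upper semi-Fredholm: upper semi-B-Fredholm with essential degree `0`. -/
def IsUpperSemiFredholm (T : E →L[ℂ] E) : Prop :=
  IsUpperSemiBFredholm T ∧ essentialDegree T = 0

/-- `T` is lower semi-Fredholm: lower semi-B-Fredholm with essential degree `0`. -/
def IsLowerSemiFredholm (T : E →L[ℂ] E) : Prop :=
  IsLowerSemiBFredholm T ∧ essentialDegree T = 0

/-- `(M, N) ∈ Red(T)`: `M` and `N` are closed `T`-invariant subspaces with `E = M ⊕ N`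
(algebraic direct sum). -/
structure IsReducedBy (T : E →L[ℂ] E) (M N : Submodule ℂ E) : Prop where
  isClosed_left : IsClosed (M : Set E)
  isClosed_right : IsClosed (N : Set E)
  invariant_left : ∀ x ∈ M, T x ∈ M
  invariant_right : ∀ x ∈ N, T x ∈ N
  isCompl : IsCompl M N

/-- `T` is quasi upper semi-B-Fredholm: for some `(M, N) ∈ Red(T)`, the restriction of `T` to `M`
is upper semi-Fredholm and the restriction of `T` to `N` is nilpotent. -/
def IsQuasiUpperSemiBFredholm (T : E →L[ℂ] E) : Prop :=
  ∃ (M N : Submodule ℂ E) (h : IsReducedBy T M N),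
    IsUpperSemiFredholm (T.restrict h.invariant_left) ∧
      IsNilpotent (T.restrict h.invariant_right)

/-- `T` is quasi lower semi-B-Fredholm: for some `(M, N) ∈ Red(T)`, the restriction of `T` to `M`
is lower semi-Fredholm and the restriction of `T` to `N` is nilpotent. -/
def IsQuasiLowerSemiBFredholm (T : E →L[ℂ] E) : Prop :=
  ∃ (M N : Submodule ℂ E) (h : IsReducedBy T M N),
    IsLowerSemiFredholm (T.restrict h.invariant_left) ∧
      IsNilpotent (T.restrict h.invariant_right)

end

end SemiBFredholm

/-! Let `T ^ p` vanish on `N`. For `n ≥ p` the range of `T ^ n` is that of its `M`-part, so both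
essential indices are at most `p`. Since the index may be smaller than `p`, closedness must be
checked at that exact index. Upper case, index `a`: the `M`-part has finite-dimensional kernel and
closed range, so its powers have closed range; the `N`-part of the range of `T ^ (a + 1)` is
finite-dimensional by `fg_of_isNilpotent`. Lower case, index `d`: the range of `T ^ d` is that of `T
^ (d + p)`, closed by `isClosed_range_of_cofg`, plus a finite-dimensional space. -/

namespace SemiBFredholm

/-! ### Inclusion modulo finite-dimensional subspaces -/

section EssentiallyLE

variable {E F : Type*} [AddCommGroup E] [Module ℂ E] [AddCommGroup F] [Module ℂ F]

/-- `P` is contained in `Q` up to a finite-dimensional subspace. -/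
def EssentiallyLE (P Q : Submodule ℂ E) : Prop :=
  ∃ G : Submodule ℂ E, G.FG ∧ P ≤ Q ⊔ G

theorem EssentiallyLE.of_le {P Q : Submodule ℂ E} (h : P ≤ Q) : EssentiallyLE P Q :=
  ⟨⊥, Submodule.fg_bot, by simpa using h⟩

theorem EssentiallyLE.trans {P Q R : Submodule ℂ E} (h₁ : EssentiallyLE P Q)
    (h₂ : EssentiallyLE Q R) : EssentiallyLE P R := by
  obtain ⟨G₁, hG₁, h₁⟩ := h₁
  obtain ⟨G₂, hG₂, h₂⟩ := h₂
  refine ⟨G₂ ⊔ G₁, hG₂.sup hG₁, h₁.trans ?_⟩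
  rw [← sup_assoc]
  exact sup_le_sup_right h₂ _

theorem EssentiallyLE.map {P Q : Submodule ℂ E} (h : EssentiallyLE P Q) (f : E →ₗ[ℂ] F) :
    EssentiallyLE (P.map f) (Q.map f) := by
  obtain ⟨G, hG, h⟩ := h
  exact ⟨G.map f, hG.map f, (Submodule.map_mono h).trans (Submodule.map_sup _ _ _).le⟩

theorem fg_of_le {P Q : Submodule ℂ E} (h : P ≤ Q) (hQ : Q.FG) : P.FG := by
  have : FiniteDimensional ℂ Q := Module.Finite.of_fg hQ
  have : FiniteDimensional ℂ P := Submodule.finiteDimensional_of_le h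
  exact Module.Finite.iff_fg.1 this

/-- The finite-dimensional defect can be chosen inside the larger space. -/
theorem EssentiallyLE.exists_eq_sup {P Q : Submodule ℂ E} (h : EssentiallyLE P Q) (hQP : Q ≤ P) :
    ∃ G : Submodule ℂ E, G.FG ∧ P = Q ⊔ G := by
  obtain ⟨G, hG, h⟩ := h
  refine ⟨G ⊓ P, fg_of_le inf_le_left hG, ?_⟩
  rw [← sup_inf_assoc_of_le _ hQP]
  exact (inf_eq_right.2 h).symm

theorem essentiallyLE_top_iff_cofg {Q : Submodule ℂ E} : EssentiallyLE ⊤ Q ↔ Q.CoFG := by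
  constructor
  · rintro ⟨G, hG, h⟩
    exact hG.cofg_of_codisjoint (codisjoint_iff.2 (by rw [sup_comm]; exact top_le_iff.1 h))
  · intro h
    obtain ⟨G, hG⟩ := Submodule.exists_isCompl Q
    exact ⟨G, h.fg_of_isCompl hG, hG.sup_eq_top.ge⟩

/-- Modulo `Q`, the space `K ⊓ P` lands in the image of a finite-dimensional `G`; what is killed
lies in `K ⊓ Q`. -/
theorem fg_inf_of_essentiallyLE {P Q K : Submodule ℂ E} (h : EssentiallyLE P Q)
    (hK : (K ⊓ Q).FG) : (K ⊓ P).FG := by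
  obtain ⟨G, hG, h⟩ := h
  refine Submodule.fg_of_fg_map_of_fg_inf_ker Q.mkQ ?_ ?_
  · refine fg_of_le ?_ (hG.map Q.mkQ)
    refine (Submodule.map_mono (inf_le_right.trans h)).trans ?_
    rw [Submodule.map_sup]
    simp
  · rw [Submodule.ker_mkQ]
    exact fg_of_le (inf_le_inf_right _ inf_le_left) hK

/-- If `f` has finite-dimensional kernel, then `EssentiallyLE` is reflected by `f`. -/
theorem EssentiallyLE.of_map {P Q : Submodule ℂ E} {f : E →ₗ[ℂ] F} (hf : f.ker.FG)
    (h : EssentiallyLE (P.map f) (Q.map f)) (hQP : Q ≤ P) : EssentiallyLE P Q := by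
  obtain ⟨G, hG, h⟩ := h.exists_eq_sup (Submodule.map_mono hQP)
  have hGP : G ≤ P.map f := h ▸ le_sup_right
  obtain ⟨s, hs⟩ := hG
  have hsub : ∀ y ∈ s, ∃ x, f x = y := fun y hy => by
    obtain ⟨x, -, hx⟩ := hGP (hs ▸ Submodule.subset_span hy)
    exact ⟨x, hx⟩
  have hle : G ≤ f.range := hGP.trans LinearMap.map_le_range
  obtain ⟨H, hH, rfl⟩ : ∃ H : Submodule ℂ E, H.FG ∧ H.map f = G := by
    choose! g hg using hsub
    refine ⟨Submodule.span ℂ (g '' s), Submodule.fg_span (s.finite_toSet.image g), ?_⟩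
    rw [Submodule.map_span, ← hs, Set.image_image]
    congr 1
    ext y
    simp only [Set.mem_image]
    exact ⟨fun ⟨x, hx, hxy⟩ => by rw [← hxy, hg x hx]; exact hx, fun hy => ⟨y, hy, hg y hy⟩⟩
  refine ⟨H ⊔ f.ker, hH.sup hf, ?_⟩
  rw [← sup_assoc, ← Submodule.comap_map_eq, ← Submodule.map_le_iff_le_comap, Submodule.map_sup]
  exact h.le

end EssentiallyLE

/-! ### Nullity and defect on ranges of powers -/

section Restriction

variable {E : Type*} [NormedAddCommGroup E] [NormedSpace ℂ E]

theorem range_pow_succ (T : E →L[ℂ] E) (n : ℕ) :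
    (T ^ (n + 1)).range = (T ^ n).range.map (T : E →ₗ[ℂ] E) := by
  rw [pow_succ']
  exact LinearMap.range_comp _ _

theorem range_pow_antitone (T : E →L[ℂ] E) : Antitone fun n : ℕ => (T ^ n).range := by
  refine antitone_nat_of_succ_le fun n => ?_
  rw [pow_succ]
  exact LinearMap.range_comp_le_range _ _

theorem range_pow_zero (T : E →L[ℂ] E) : (T ^ 0).range = ⊤ := by
  rw [pow_zero]
  exact LinearMap.range_id

theorem nullity_restrictRangePow_lt_top_iff (T : E →L[ℂ] E) (n : ℕ) :
    nullity (restrictRangePow T n) < ⊤ ↔ (T.ker ⊓ (T ^ n).range).FG := by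
  rw [nullity, Cardinal.toENat_lt_top, Module.rank_lt_aleph0_iff, Module.Finite.iff_fg]
  have h : (restrictRangePow T n).ker.map (T ^ n).range.subtype = T.ker ⊓ (T ^ n).range := by
    ext x
    simp only [Submodule.mem_map, Submodule.mem_inf]
    constructor
    · rintro ⟨y, hy, rfl⟩
      exact ⟨congrArg Subtype.val hy, y.2⟩
    · rintro ⟨hx, hx'⟩
      exact ⟨⟨x, hx'⟩, Subtype.ext hx, rfl⟩
  rw [← h]
  exact ⟨fun H => H.map _, Submodule.fg_of_fg_map_injective _ (Submodule.subtype_injective _)⟩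

theorem defect_restrictRangePow_lt_top_iff (T : E →L[ℂ] E) (n : ℕ) :
    defect (restrictRangePow T n) < ⊤ ↔ EssentiallyLE (T ^ n).range (T ^ (n + 1)).range := by
  rw [defect, Cardinal.toENat_lt_top, Module.rank_lt_aleph0_iff]
  change Submodule.CoFG _ ↔ _
  rw [← essentiallyLE_top_iff_cofg]
  have h : (restrictRangePow T n).range.map (T ^ n).range.subtype = (T ^ (n + 1)).range := by
    rw [range_pow_succ]
    ext x
    simp only [Submodule.mem_map]
    constructor
    · rintro ⟨_, ⟨z, rfl⟩, rfl⟩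
      exact ⟨z, z.2, rfl⟩
    · rintro ⟨z, hz, rfl⟩
      exact ⟨_, ⟨⟨z, hz⟩, rfl⟩, rfl⟩
  constructor
  · intro H
    simpa [h] using H.map (T ^ n).range.subtype
  · intro H
    refine EssentiallyLE.of_map (f := (T ^ n).range.subtype) ?_ ?_ le_top
    · simpa using Submodule.fg_bot
    · simpa [h] using H

theorem EssentiallyLE.range_pow_add {T : E →L[ℂ] E} {n : ℕ}
    (h : EssentiallyLE (T ^ n).range (T ^ (n + 1)).range) (k : ℕ) :
    EssentiallyLE (T ^ n).range (T ^ (n + k)).range := by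
  have step : ∀ j, EssentiallyLE (T ^ (n + j)).range (T ^ (n + j + 1)).range := by
    intro j
    induction j with
    | zero => exact h
    | succ j ih =>
      rw [range_pow_succ T (n + (j + 1)), ← add_assoc, range_pow_succ T (n + j)]
      rw [range_pow_succ T (n + j)] at ih
      exact ih.map _
  induction k with
  | zero => exact EssentiallyLE.of_le le_rfl
  | succ k ih => exact ih.trans (step k)

/-- A finite-dimensional kernel lets one factor `T` at a time be cancelled. -/
theorem EssentiallyLE.range_pow_zero_of_ker_fg {T : E →L[ℂ] E} (hT : T.ker.FG) {n : ℕ}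
    (h : EssentiallyLE (T ^ n).range (T ^ (n + 1)).range) :
    EssentiallyLE (T ^ 0).range (T ^ 1).range := by
  induction n with
  | zero => exact h
  | succ n ih =>
    refine ih ?_
    rw [range_pow_succ T (n + 1), range_pow_succ T n] at h
    rw [range_pow_succ T n]
    refine h.of_map hT ?_
    rw [← range_pow_succ T n]
    exact range_pow_antitone T n.le_succ

end Restriction

/-! ### Attainment of infima in `ℕ∞` -/

section ExtendedInfimum

theorem sInf_natCast_image_mem {S : Set ℕ} {a : ℕ}
    (h : sInf ((fun n : ℕ => (n : ℕ∞)) '' S) = a) : a ∈ S := by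
  have hne : ((fun n : ℕ => (n : ℕ∞)) '' S).Nonempty := by
    by_contra hS
    rw [Set.not_nonempty_iff_eq_empty.1 hS, sInf_empty] at h
    exact ENat.natCast_ne_top a h.symm
  obtain ⟨n, hn, hna⟩ := csInf_mem hne
  rw [h] at hna
  exact Nat.cast_injective (R := ℕ∞) hna ▸ hn

theorem exists_sInf_natCast_image_eq {S : Set ℕ} (hS : S.Nonempty) :
    ∃ a ∈ S, sInf ((fun n : ℕ => (n : ℕ∞)) '' S) = a := by
  obtain ⟨n, hn, hna⟩ := csInf_mem (hS.image fun n : ℕ => (n : ℕ∞))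
  exact ⟨n, hn, hna.symm⟩

theorem sInf_natCast_image_eq_zero {S : Set ℕ} (hS : 0 ∈ S) :
    sInf ((fun n : ℕ => (n : ℕ∞)) '' S) = 0 :=
  nonpos_iff_eq_zero.1 (sInf_le ⟨0, hS, rfl⟩)

end ExtendedInfimum

/-! ### Semi-Fredholm operators and closed ranges -/

section Banach

variable {E : Type*} [NormedAddCommGroup E] [NormedSpace ℂ E]

/-- Essential degree `0` only makes the nullity or the defect finite. If it is the defect, all
ranges of powers have finite codimension, so finiteness of the kernel on one of them passes to the
whole kernel. -/
theorem IsUpperSemiFredholm.ker_fg_and_isClosed_range {T : E →L[ℂ] E}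
    (h : IsUpperSemiFredholm T) : T.ker.FG ∧ IsClosed (T.range : Set E) := by
  obtain ⟨⟨a, ha, hcl⟩, hm⟩ := h
  have hker : T.ker.FG := by
    have h0 := sInf_natCast_image_mem (a := 0) hm
    rw [Set.mem_ofPred_eq, min_lt_iff, nullity_restrictRangePow_lt_top_iff,
      defect_restrictRangePow_lt_top_iff] at h0
    rcases h0 with h0 | h0
    · rwa [range_pow_zero, inf_top_eq] at h0
    · have h1 := sInf_natCast_image_mem ha
      rw [Set.mem_ofPred_eq, nullity_restrictRangePow_lt_top_iff] at h1
      have h2 := h0.range_pow_add a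
      rw [zero_add, range_pow_zero] at h2
      simpa only [inf_top_eq] using fg_inf_of_essentiallyLE h2 h1
  have ha0 : a = 0 := by
    have : essentialAscent T = 0 := sInf_natCast_image_eq_zero (by
      rw [Set.mem_ofPred_eq, nullity_restrictRangePow_lt_top_iff]
      exact fg_of_le inf_le_left hker)
    rw [ha] at this
    exact_mod_cast this
  subst ha0
  rw [zero_add, pow_one] at hcl
  exact ⟨hker, hcl⟩

theorem IsLowerSemiFredholm.essentiallyLE_range {T : E →L[ℂ] E}
    (h : IsLowerSemiFredholm T) : EssentiallyLE (T ^ 0).range (T ^ 1).range := by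
  obtain ⟨⟨d, hd, -⟩, hm⟩ := h
  have h0 := sInf_natCast_image_mem (a := 0) hm
  rw [Set.mem_ofPred_eq, min_lt_iff, nullity_restrictRangePow_lt_top_iff,
    defect_restrictRangePow_lt_top_iff] at h0
  rcases h0 with h0 | h0
  · have h1 := sInf_natCast_image_mem hd
    rw [Set.mem_ofPred_eq, defect_restrictRangePow_lt_top_iff] at h1
    exact h1.range_pow_zero_of_ker_fg (by rwa [range_pow_zero, inf_top_eq] at h0)
  · exact h0

theorem isClosed_sup_of_fg {P G : Submodule ℂ E} (hP : IsClosed (P : Set E)) (hG : G.FG) :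
    IsClosed ((P ⊔ G : Submodule ℂ E) : Set E) := by
  have : FiniteDimensional ℂ G := Module.Finite.of_fg hG
  exact Submodule.isClosed_sup_finiteDimensional P G hP

variable [CompleteSpace E]

theorem isClosed_map_of_ker_fg {T : E →L[ℂ] E} (hker : T.ker.FG)
    (hcl : IsClosed (T.range : Set E)) {P : Submodule ℂ E} (hP : IsClosed (P : Set E)) :
    IsClosed (P.map (T : E →ₗ[ℂ] E) : Set E) := by
  have : CompleteSpace T.range := hcl.completeSpace_coe
  have hq := ContinuousLinearMap.isQuotientMap (T.rangeRestrict)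
    (LinearMap.surjective_rangeRestrict (T : E →ₗ[ℂ] E))
  have h1 : IsClosed ((↑) ⁻¹' (P.map (T : E →ₗ[ℂ] E) : Set E) : Set T.range) := by
    -- By the open mapping theorem `T` is a quotient map onto its closed range, so closedness can be
    -- tested on the preimage `P ⊔ T.ker`.
    rw [← hq.isClosed_preimage]
    have : T.rangeRestrict ⁻¹' ((↑) ⁻¹' (P.map (T : E →ₗ[ℂ] E) : Set E) : Set T.range)
        = ((P ⊔ T.ker : Submodule ℂ E) : Set E) := by
      rw [← Submodule.comap_map_eq]
      rfl
    rw [this]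
    exact isClosed_sup_of_fg hP hker
  have h2 : (Subtype.val : T.range → E) '' (Subtype.val ⁻¹' (P.map (T : E →ₗ[ℂ] E) : Set E)) =
      (P.map (T : E →ₗ[ℂ] E) : Set E) := Set.image_preimage_eq_of_subset (by
    rw [Subtype.range_coe]
    exact LinearMap.map_le_range)
  rw [← h2]
  exact hcl.isClosedEmbedding_subtypeVal.isClosedMap _ h1

theorem isClosed_range_pow_of_ker_fg {T : E →L[ℂ] E} (hker : T.ker.FG)
    (hcl : IsClosed (T.range : Set E)) (n : ℕ) : IsClosed ((T ^ n).range : Set E) := by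
  induction n with
  | zero =>
    rw [range_pow_zero]
    exact isClosed_univ
  | succ n ih =>
    rw [range_pow_succ]
    exact isClosed_map_of_ker_fg hker hcl ih

/-- A bounded operator between Banach spaces whose range has finite codimension has closed
range. -/
theorem isClosed_range_of_cofg {F : Type*} [NormedAddCommGroup F] [NormedSpace ℂ F]
    [CompleteSpace F] {T : E →L[ℂ] F} (h : T.range.CoFG) : IsClosed (T.range : Set F) := by
  obtain ⟨G, hG⟩ := Submodule.exists_isCompl T.range
  have : FiniteDimensional ℂ G := Module.Finite.of_fg (h.fg_of_isCompl hG)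
  have : CompleteSpace G := FiniteDimensional.complete ℂ G
  -- Adjoining a complement `G` makes the map onto, hence a quotient map; the range of `T` pulls
  -- back to `E × {0}`.
  let φ : E × G →L[ℂ] F := T.coprod G.subtypeL
  have hsurj : Function.Surjective φ := by
    intro y
    obtain ⟨_, ⟨x, rfl⟩, g, hg, rfl⟩ :=
      Submodule.mem_sup.1 (hG.sup_eq_top.ge (Submodule.mem_top (x := y)))
    exact ⟨(x, ⟨g, hg⟩), rfl⟩
  rw [← (φ.isQuotientMap hsurj).isClosed_preimage]
  have : φ ⁻¹' (T.range : Set F) = Prod.snd ⁻¹' ({0} : Set G) := by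
    ext ⟨x, g⟩
    have hx : T x ∈ T.range := ⟨x, rfl⟩
    change T x + (g : F) ∈ T.range ↔ g = 0
    rw [Submodule.add_mem_iff_right _ hx]
    exact ⟨fun hg => Subtype.ext (Submodule.disjoint_def.1 hG.disjoint _ hg g.2),
      fun hg => by simp [hg]⟩
  rw [this]
  exact isClosed_singleton.preimage continuous_snd

end Banach

/-! ### Reducing pairs with a nilpotent summand -/

section Reduced

variable {E : Type*} [NormedAddCommGroup E] [NormedSpace ℂ E] {T : E →L[ℂ] E}
  {M N : Submodule ℂ E}

theorem coe_restrict_pow_apply (h : ∀ x ∈ M, T x ∈ M) (n : ℕ) (x : M) :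
    (((T.restrict h) ^ n) x : E) = (T ^ n) x := by
  induction n generalizing x with
  | zero => rfl
  | succ n ih =>
    rw [pow_succ, pow_succ]
    exact ih _

theorem map_range_restrict_pow (h : ∀ x ∈ M, T x ∈ M) (n : ℕ) :
    ((T.restrict h) ^ n).range.map M.subtype = M.map ((T ^ n : E →L[ℂ] E) : E →ₗ[ℂ] E) := by
  ext y
  simp only [Submodule.mem_map]
  constructor
  · rintro ⟨_, ⟨x, rfl⟩, rfl⟩
    exact ⟨x, x.2, (coe_restrict_pow_apply h n x).symm⟩
  · rintro ⟨x, hx, rfl⟩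
    exact ⟨_, ⟨⟨x, hx⟩, rfl⟩, coe_restrict_pow_apply h n ⟨x, hx⟩⟩

theorem IsReducedBy.range_pow (h : IsReducedBy T M N) (n : ℕ) :
    (T ^ n).range = ((T.restrict h.invariant_left) ^ n).range.map M.subtype ⊔
      ((T.restrict h.invariant_right) ^ n).range.map N.subtype := by
  rw [map_range_restrict_pow, map_range_restrict_pow, ← Submodule.map_sup, h.isCompl.sup_eq_top]
  exact LinearMap.range_eq_map _

theorem IsReducedBy.range_pow_of_pow_eq_zero (h : IsReducedBy T M N) {n : ℕ}
    (hn : (T.restrict h.invariant_right) ^ n = 0) :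
    (T ^ n).range = ((T.restrict h.invariant_left) ^ n).range.map M.subtype := by
  have hz : ((T.restrict h.invariant_right) ^ n).range = ⊥ := by
    rw [hn]
    exact LinearMap.range_zero
  rw [h.range_pow, hz, Submodule.map_bot, sup_bot_eq]

theorem isClosed_map_subtype (hM : IsClosed (M : Set E)) {P : Submodule ℂ M}
    (hP : IsClosed (P : Set M)) : IsClosed (P.map M.subtype : Set E) :=
  hM.isClosedEmbedding_subtypeVal.isClosedMap _ hP

/-- An invariant subspace of a nilpotent operator which meets the kernel in a finite-dimensional
subspace is finite-dimensional. -/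
theorem fg_of_isNilpotent {S : E →L[ℂ] E} (hS : IsNilpotent S) {W : Submodule ℂ E}
    -- The proof climbs the kernels of powers: `S` sends `(S ^ (j + 1)).ker ⊓ W` into `(S ^ j).ker ⊓
    -- W`.
    (hW : ∀ x ∈ W, S x ∈ W) (hker : (S.ker ⊓ W).FG) : W.FG := by
  obtain ⟨k, hk⟩ := hS
  have key : ∀ j : ℕ, ((S ^ j).ker ⊓ W).FG := by
    intro j
    induction j with
    | zero =>
      have : (S ^ 0).ker = ⊥ := by
        rw [pow_zero]
        exact LinearMap.ker_id
      rw [this, bot_inf_eq]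
      exact Submodule.fg_bot
    | succ j ih =>
      refine Submodule.fg_of_fg_map_of_fg_inf_ker (S : E →ₗ[ℂ] E) (fg_of_le ?_ ih)
        (fg_of_le ?_ hker)
      · rintro _ ⟨x, ⟨hx, hxW⟩, rfl⟩
        refine ⟨?_, hW x hxW⟩
        have hx' : (S ^ (j + 1)) x = 0 := hx
        rw [pow_succ] at hx'
        exact hx'
      · rintro x ⟨⟨-, hxW⟩, hx⟩
        exact ⟨hx, hxW⟩
  have hker_eq : (S ^ k).ker = ⊤ := by
    rw [hk]
    exact LinearMap.ker_zero
  simpa only [hker_eq, top_inf_eq] using key k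

theorem IsReducedBy.isUpperSemiBFredholm [CompleteSpace E] (h : IsReducedBy T M N)
    (hM : IsUpperSemiFredholm (T.restrict h.invariant_left))
    (hN : IsNilpotent (T.restrict h.invariant_right)) : IsUpperSemiBFredholm T := by
  have : CompleteSpace M := h.isClosed_left.completeSpace_coe
  obtain ⟨hker, hcl⟩ := hM.ker_fg_and_isClosed_range
  obtain ⟨p, hp⟩ := id hN
  obtain ⟨a, ha, haeq⟩ := exists_sInf_natCast_image_eq
    (S := {n | nullity (restrictRangePow T n) < ⊤}) ⟨p, by
      rw [Set.mem_ofPred_eq, nullity_restrictRangePow_lt_top_iff]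
      refine fg_of_le ?_ (hker.map M.subtype)
      rintro x ⟨hx, hxp⟩
      rw [h.range_pow_of_pow_eq_zero hp] at hxp
      obtain ⟨y, -, rfl⟩ := hxp
      exact ⟨y, Subtype.ext hx, rfl⟩⟩
  refine ⟨a, haeq, ?_⟩
  rw [Set.mem_ofPred_eq, nullity_restrictRangePow_lt_top_iff] at ha
  rw [h.range_pow]
  refine isClosed_sup_of_fg (isClosed_map_subtype h.isClosed_left
    (isClosed_range_pow_of_ker_fg hker hcl _)) (Submodule.FG.map _ ?_)
  -- Minimality of `a` plays no role: finite nullity on the range of `T ^ a` bounds the `N`-part at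
  -- exponent `a`, hence at `a + 1`.
  refine fg_of_le (range_pow_antitone _ a.le_succ)
    (fg_of_isNilpotent hN (apply_mem_range_pow _ a) ?_)
  refine Submodule.fg_of_fg_map_injective N.subtype (Submodule.subtype_injective N) ?_
  refine fg_of_le ?_ ha
  rintro _ ⟨x, ⟨hx, y, rfl⟩, rfl⟩
  exact ⟨congrArg Subtype.val hx, y, (coe_restrict_pow_apply _ a y).symm⟩

theorem IsReducedBy.isLowerSemiBFredholm [CompleteSpace E] (h : IsReducedBy T M N)
    (hM : IsLowerSemiFredholm (T.restrict h.invariant_left))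
    (hN : IsNilpotent (T.restrict h.invariant_right)) : IsLowerSemiBFredholm T := by
  have : CompleteSpace M := h.isClosed_left.completeSpace_coe
  have hle := hM.essentiallyLE_range
  obtain ⟨p, hp⟩ := hN
  have htop : ∀ n, EssentiallyLE ⊤ ((T.restrict h.invariant_left) ^ n).range := fun n => by
    have h := hle.range_pow_add n
    rwa [zero_add, range_pow_zero] at h
  have hcl : ∀ n, IsClosed (((T.restrict h.invariant_left) ^ n).range : Set M) := fun n =>
    isClosed_range_of_cofg (essentiallyLE_top_iff_cofg.1 (htop n))
  have hzero : ∀ n, p ≤ n → (T.restrict h.invariant_right) ^ n = 0 := fun n hn =>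
    pow_eq_zero_of_le hn hp
  obtain ⟨d, hd, hdeq⟩ := exists_sInf_natCast_image_eq
    (S := {n | defect (restrictRangePow T n) < ⊤}) ⟨p, by
      rw [Set.mem_ofPred_eq, defect_restrictRangePow_lt_top_iff,
        h.range_pow_of_pow_eq_zero (hzero p le_rfl),
        h.range_pow_of_pow_eq_zero (hzero (p + 1) p.le_succ)]
      exact ((EssentiallyLE.of_le le_top).trans (htop (p + 1))).map _⟩
  refine ⟨d, hdeq, ?_⟩
  rw [Set.mem_ofPred_eq, defect_restrictRangePow_lt_top_iff] at hd
  -- Moving `p` steps further kills the `N`-part at only finite-dimensional cost.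
  obtain ⟨G, hG, hGeq⟩ := (hd.range_pow_add p).exists_eq_sup
    (range_pow_antitone T (Nat.le_add_right d p))
  rw [hGeq, h.range_pow_of_pow_eq_zero (hzero (d + p) (Nat.le_add_left p d))]
  exact isClosed_sup_of_fg (isClosed_map_subtype h.isClosed_left (hcl _)) hG

end Reduced

end SemiBFredholm

theorem mainTheorem9 {X : Type*} [NormedAddCommGroup X] [NormedSpace ℂ X] [CompleteSpace X]
    (T : X →L[ℂ] X) :
    (SemiBFredholm.IsQuasiUpperSemiBFredholm T → SemiBFredholm.IsUpperSemiBFredholm T) ∧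
      (SemiBFredholm.IsQuasiLowerSemiBFredholm T → SemiBFredholm.IsLowerSemiBFredholm T) :=
  ⟨fun ⟨_, _, h, hM, hN⟩ => h.isUpperSemiBFredholm hM hN,
    fun ⟨_, _, h, hM, hN⟩ => h.isLowerSemiBFredholm hM hN⟩
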